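/- Let $G=(V,E)$ be a finite simple graph with $e(G)$ edges, largest degree $\Delta$ and average degree $\overline{d}$. For real $x\in(-1,1)$ let $\mathcal{A}(G,x)$ be the set of positive definite real symmetric $V\times V$ matrices $M$ with $M_{v,v}=1$ for every $v\in V$ and $M_{u,v}=x$ for every edge $(u,v)$ of $G$, and, whenever the maximum exists, let $\tau(G,x)=\max_{M\in\mathcal{A}(G,x)}\det M$ (for $x\in[0,1)$ and for $x<0$ close to $0$ it does exist). Let $K_2$ be the graph consisting of a single edge. Let $x\in[0,1)$ be such that either $x\le \frac{1}{\Delta-1}$ (a condition regarded as satisfied by all $x$ if $\Delta\le 1$), or $\overline{d}>1$ and $x\ge\frac{1}{\overline{d}-1}$. Then $\tau(G,x)>0$, the function $t\mapsto\tau(G,t)$ is differentiable at $x$, and $$\frac{\tau'(G,x)}{\tau(G,x)}\ \ge\ e(G)\,\frac{\tau'(K_2,x)}{\tau(K_2,x)},$$ where $'$ denotes the derivative in $x$. -/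

import Mathlib

noncomputable section

/-- The set of positive definite real `V × V` matrices with unit diagonal whose entries
indexed by the edges of `G` are all equal to `x`. -/
def admissible {V : Type*} (G : SimpleGraph V) (x : ℝ) : Set (Matrix V V ℝ) :=
  {M | M.PosDef ∧ (∀ i, M i i = 1) ∧ ∀ i j, G.Adj i j → M i j = x}

open Classical in
/-- The matrix which maximizes the determinant over `admissible G x`
(and the zero matrix if the maximum is not attained). -/
def maxDetMatrix {V : Type*} [Fintype V] [DecidableEq V] (G : SimpleGraph V) (x : ℝ) : Matrix V V ℝ :=
  if h : ∃ A ∈ admissible G x, ∀ M ∈ admissible G x, M.det ≤ A.det then h.choose else 0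

/-- The maximal determinant over `admissible G x`. -/
def tau {V : Type*} [Fintype V] [DecidableEq V] (G : SimpleGraph V) (x : ℝ) : ℝ :=
  (maxDetMatrix G x).det

/-- The average degree of a finite graph. -/
def averageDegree {V : Type*} [Fintype V] (G : SimpleGraph V) [DecidableRel G.Adj] : ℝ :=
  (∑ v, (G.degree v : ℝ)) / (Fintype.card V : ℝ)

end

open Matrix Filter Topology

/-! ### Differentiation by squeezing -/

section Squeeze

/-! Let M be the optimal matrix, P = M⁻¹ and A the adjacency matrix. Stationarity makes P vanish at
non-edges, and concavity of log det gives τ'/τ = tr(PA), the sum of P over ordered adjacent pairs.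
For `K_2` the ratio is -2x/(1-x²), so the claim is that P is at least -x/(1-x²) on average over the
edges.

For small x this holds at every edge. Relax the edge constraint to "entry ≥ x": the optimum then has
P ≤ 0 off the diagonal, with P_uv = 0 wherever M_uv ≠ x. The path product inequality M_uv M_vw ≤
M_uw, put into PM = 1, gives the edge bound (`IsComplementary.neg_le_inv_apply`). With x(Δ-1) ≤ 1
that bound makes the row sums of P nonnegative, and a minimum principle then forces all off-diagonal
entries of M to be at most x (`IsComplementary.apply_le`). Hence the relaxed optimum solves the
original problem.

For large x only the total is estimated: tr(PM) = n and 1ᵀP1 ≥ 0 give (1-x) tr(PA) ≥ -n, which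
suffices once x(d̄-1) ≥ 1. -/

theorem hasDerivAt_of_squeeze {f l u : ℝ → ℝ} {c x : ℝ} (hl : HasDerivAt l c x)
    (hu : HasDerivAt u c x) (hlf : ∀ᶠ t in 𝓝 x, l t ≤ f t) (hfu : ∀ᶠ t in 𝓝 x, f t ≤ u t)
    (hlx : l x = f x) (hux : u x = f x) : HasDerivAt f c x := by
  rw [hasDerivAt_iff_isLittleO] at *
  have h := hl.norm_left.add hu.norm_left
  refine (Asymptotics.IsBigO.of_bound 1 ?_).trans_isLittleO h
  filter_upwards [hlf, hfu] with t h1 h2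
  rw [hlx, hux, one_mul]
  simp only [Real.norm_eq_abs, smul_eq_mul]
  refine le_trans ?_ (le_abs_self _)
  rw [abs_le]
  constructor
  · have := neg_abs_le (l t - f x - (t - x) * c)
    have := abs_nonneg (u t - f x - (t - x) * c)
    linarith
  · have := le_abs_self (u t - f x - (t - x) * c)
    have := abs_nonneg (l t - f x - (t - x) * c)
    linarith

end Squeeze

/-! ### Determinants and positive definite matrices -/

namespace Matrix

variable {n : Type*} [Fintype n] [DecidableEq n]

/-- Multiply λ ≤ exp(λ - 1) over the eigenvalues. -/
theorem PosSemidef.det_le_exp_trace_sub_card {B : Matrix n n ℝ} (hB : B.PosSemidef) :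
    B.det ≤ Real.exp (B.trace - Fintype.card n) := by
  rw [hB.1.det_eq_prod_eigenvalues, hB.1.trace_eq_sum_eigenvalues]
  have h : ((∑ i, ((hB.1.eigenvalues i : ℝ) : ℝ)) - Fintype.card n) =
      ∑ i, (hB.1.eigenvalues i - 1) := by
    simp [Finset.sum_sub_distrib]
  simp only [RCLike.ofReal_real_eq_id, id_eq]
  rw [h, Real.exp_sum]
  refine Finset.prod_le_prod (fun i _ => hB.eigenvalues_nonneg i) fun i _ => ?_
  have := Real.add_one_le_exp (hB.1.eigenvalues i - 1)
  linarith

open scoped MatrixOrder in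
/-- The supporting-hyperplane form of the concavity of `log ∘ det`. -/
theorem PosDef.det_le_det_mul_exp_trace {M N : Matrix n n ℝ} (hM : M.PosDef)
    (hN : N.PosSemidef) : N.det ≤ M.det * Real.exp ((M⁻¹ * (N - M)).trace) := by
  obtain ⟨C, hC⟩ :=
    CStarAlgebra.nonneg_iff_eq_star_mul_self.mp hM.inv.posSemidef.nonneg
  rw [star_eq_conjTranspose] at hC
  -- With M⁻¹ = CᴴC, the matrix CNCᴴ is a semidefinite stand-in for M⁻¹N, with the same determinant
  -- and trace.
  have h := (hN.mul_mul_conjTranspose_same C).det_le_exp_trace_sub_card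
  have hdet : (C * N * Cᴴ).det = M.det⁻¹ * N.det := by
    rw [det_mul, det_mul, mul_right_comm, ← det_mul, mul_comm, det_mul_comm, ← hC,
      det_nonsing_inv, Ring.inverse_eq_inv', mul_comm]
  have htr : (C * N * Cᴴ).trace = (M⁻¹ * N).trace := by
    rw [trace_mul_comm, ← Matrix.mul_assoc, ← hC]
  have hu : IsUnit M.det := hM.det_pos.ne'.isUnit
  rw [Matrix.mul_sub, trace_sub, nonsing_inv_mul _ hu, trace_one, ← htr]
  rw [hdet, inv_mul_le_iff₀ hM.det_pos] at h
  exact h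

theorem hasDerivAt_det_add_smul {M : Matrix n n ℝ} (hM : IsUnit M.det) (E : Matrix n n ℝ) :
    HasDerivAt (fun s : ℝ => (M + s • E).det) (M.det * (M⁻¹ * E).trace) 0 := by
  have h : ∀ s : ℝ, (M + s • E).det = M.det * (1 + (M⁻¹ * E).trace * s +
      (det (1 + (Polynomial.X : Polynomial ℝ) • (M⁻¹ * E).map Polynomial.C)).divX.divX.eval s
        * s ^ 2) := by
    intro s
    rw [← det_one_add_smul, ← det_mul, Matrix.mul_add, Matrix.mul_one, Matrix.mul_smul,
      ← Matrix.mul_assoc, mul_nonsing_inv _ hM, Matrix.one_mul]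
  simp_rw [h]
  have h2 := ((((hasDerivAt_id (0 : ℝ)).const_mul (M⁻¹ * E).trace).const_add 1).add
    (((det (1 + (Polynomial.X : Polynomial ℝ) • (M⁻¹ * E).map
      Polynomial.C)).divX.divX.hasDerivAt 0).mul ((hasDerivAt_id (0 : ℝ)).pow 2))).const_mul M.det
  exact h2.congr_deriv (by simp)

omit [DecidableEq n] in
theorem PosDef.eventually_add_smul {M E : Matrix n n ℝ} (hM : M.PosDef) (hE : E.IsHermitian) :
    ∀ᶠ s in 𝓝 (0 : ℝ), (M + s • E).PosDef := by
  have h : ∀ᶠ s in 𝓝 (0 : ℝ), ∀ v ∈ Metric.sphere (0 : n → ℝ) 1,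
      0 < v ⬝ᵥ ((M + s • E) *ᵥ v) := by
    refine (isCompact_sphere _ _).eventually_forall_of_forall_eventually fun v hv => ?_
    have hc : Continuous fun z : ℝ × (n → ℝ) => z.2 ⬝ᵥ ((M + z.1 • E) *ᵥ z.2) := by fun_prop
    have hv0 : v ≠ 0 := by
      rintro rfl
      simp at hv
    refine hc.continuousAt.eventually_const_lt ?_
    simpa using hM.dotProduct_mulVec_pos hv0
  filter_upwards [h] with s hs
  refine .of_dotProduct_mulVec_pos (hM.1.add (hE.smul (IsSelfAdjoint.all s))) fun v hv => ?_
  have hn : ‖v‖ ≠ 0 := norm_ne_zero_iff.2 hv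
  have h1 := hs (‖v‖⁻¹ • v) (by simp [norm_smul, hn])
  rw [mulVec_smul, smul_dotProduct, dotProduct_smul, smul_smul, smul_eq_mul] at h1
  simpa using pos_of_mul_pos_right h1 (by positivity)

theorem PosSemidef.abs_apply_le_one {M : Matrix n n ℝ} (hM : M.PosSemidef)
    (hd : ∀ i, M i i = 1) (i j : n) : |M i j| ≤ 1 := by
  have hs : M j i = M i j := by simpa using hM.1.apply i j
  -- The quadratic form at e_i + s e_j, used at s = ±1.
  have key : ∀ s : ℝ, 0 ≤ 1 + s * M i j + s * (M i j + s) := by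
    intro s
    have h := hM.dotProduct_mulVec_nonneg (Pi.single i 1 + Pi.single j s)
    simpa [mulVec_add, add_dotProduct, dotProduct_add, hd, hs, mul_comm, mul_left_comm] using h
  rw [abs_le]
  constructor
  · linarith [key 1]
  · linarith [key (-1)]

omit [DecidableEq n] in
/-- A minimum principle for positive definite matrices with nonpositive off-diagonal entries. -/
theorem PosDef.nonneg_of_mulVec_nonneg {P : Matrix n n ℝ} (hP : P.PosDef)
    (hoff : ∀ i j, i ≠ j → P i j ≤ 0) {g : n → ℝ} (hg : ∀ i, g i < 0 → 0 ≤ (P *ᵥ g) i) (i : n) :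
    0 ≤ g i := by
  set k : n → ℝ := fun i => max (-g i) 0 with hk
  have h1 : 0 ≤ k ⬝ᵥ (P *ᵥ g) := by
    refine Finset.sum_nonneg fun i _ => ?_
    rcases lt_or_ge (g i) 0 with h | h
    · exact mul_nonneg (le_max_right _ _) (hg i h)
    · simp [hk, h]
  -- `k` and `g + k` are the negative and positive parts of `g`, with disjoint supports, so only
  -- off-diagonal entries of `P` contribute. With `h1` this gives kᵀPk ≤ 0, hence k = 0.
  have h2 : k ⬝ᵥ (P *ᵥ (g + k)) ≤ 0 := by
    simp only [dotProduct, mulVec, Finset.mul_sum]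
    refine Finset.sum_nonpos fun i _ => Finset.sum_nonpos fun j _ => ?_
    have hkj : 0 ≤ (g + k) j := by
      simp only [Pi.add_apply, hk]
      linarith [le_max_left (-g j) 0]
    rcases eq_or_ne i j with rfl | hij
    · have : k i * (g + k) i = 0 := by
        simp only [Pi.add_apply, hk]
        rcases le_total (g i) 0 with h | h <;> simp [h]
      rw [mul_left_comm, this, mul_zero]
    · exact mul_nonpos_of_nonneg_of_nonpos (le_max_right _ _)
        (mul_nonpos_of_nonpos_of_nonneg (hoff i j hij) hkj)
  rw [mulVec_add, dotProduct_add] at h2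
  have hk0 : k = 0 := by
    by_contra hne
    have := hP.dotProduct_mulVec_pos hne
    simp only [star_trivial] at this
    linarith
  have := congrFun hk0 i
  simp only [hk, Pi.zero_apply, max_eq_right_iff] at this
  linarith

end Matrix

/-! ### The extremal problem: existence, stationarity, derivative of τ -/

section Relaxed

variable {V : Type*}

/-- Positive definite matrices with unit diagonal whose entries at the edges of `G` lie in `C`. -/
def admissibleIn (G : SimpleGraph V) (C : Set ℝ) : Set (Matrix V V ℝ) :=
  {M | M.PosDef ∧ (∀ i, M i i = 1) ∧ ∀ i j, G.Adj i j → M i j ∈ C}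

variable [Fintype V] [DecidableEq V]

theorem isCompact_posSemidef_unit_diag (G : SimpleGraph V) {C : Set ℝ} (hC : IsClosed C) :
    IsCompact {M : Matrix V V ℝ |
      M.PosSemidef ∧ (∀ i, M i i = 1) ∧ ∀ i j, G.Adj i j → M i j ∈ C} := by
  have hK : IsCompact (Set.univ.pi fun _ : V => Set.univ.pi fun _ : V => Set.Icc (-1 : ℝ) 1) :=
    isCompact_univ_pi fun _ => isCompact_univ_pi fun _ => isCompact_Icc
  have hcont : ∀ i j, Continuous fun M : Matrix V V ℝ => M i j := fun i j =>
    continuous_id.matrix_elem i j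
  refine hK.of_isClosed_subset ?_ fun M hM i _ j _ => abs_le.1 (hM.1.abs_apply_le_one hM.2.1 i j)
  simp only [posSemidef_iff_dotProduct_mulVec, Set.ofPred_and, Set.ofPred_forall]
  refine ((isClosed_eq (by fun_prop) continuous_id).inter (isClosed_iInter fun v =>
    isClosed_le continuous_const (by fun_prop))).inter ((isClosed_iInter fun i =>
      isClosed_eq (hcont i i) continuous_const).inter (isClosed_iInter fun i =>
        isClosed_iInter fun j => isClosed_iInter fun _ => hC.preimage (hcont i j)))

/-- Maximize over the compact semidefinite closure; a feasible definite matrix makes the maximum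
positive, so the maximizer is itself definite. -/
theorem exists_det_max (G : SimpleGraph V) {C : Set ℝ} (hC : IsClosed C)
    (hne : (admissibleIn G C).Nonempty) :
    ∃ M ∈ admissibleIn G C, ∀ N ∈ admissibleIn G C, N.det ≤ M.det := by
  obtain ⟨N, hN⟩ := hne
  obtain ⟨M, hM, hmax⟩ := (isCompact_posSemidef_unit_diag G hC).exists_isMaxOn
    ⟨N, hN.1.posSemidef, hN.2⟩ (continuous_id.matrix_det).continuousOn
  have hmax' : ∀ N ∈ admissibleIn G C, N.det ≤ M.det := fun N hN =>
    hmax (a := N) ⟨hN.1.posSemidef, hN.2⟩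
  have hpos : 0 < M.det := hN.1.det_pos.trans_le (hmax' N hN)
  exact ⟨M, ⟨hM.1.posDef_iff_isUnit.2 ((isUnit_iff_isUnit_det M).2 hpos.ne'.isUnit), hM.2⟩, hmax'⟩

theorem tau_eq_det {G : SimpleGraph V} {x : ℝ} {M : Matrix V V ℝ} (hM : M ∈ admissible G x)
    (hmax : ∀ N ∈ admissible G x, N.det ≤ M.det) : tau G x = M.det := by
  have h : ∃ A ∈ admissible G x, ∀ M ∈ admissible G x, M.det ≤ A.det := ⟨M, hM, hmax⟩
  have hs := h.choose_spec
  rw [tau, maxDetMatrix, dif_pos h]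
  exact le_antisymm (hmax _ hs.1) (hs.2 _ hM)

theorem exists_tau_eq_det {G : SimpleGraph V} {x : ℝ} (hne : (admissible G x).Nonempty) :
    ∃ M ∈ admissible G x, tau G x = M.det ∧ ∀ N ∈ admissible G x, N.det ≤ M.det := by
  obtain ⟨M, hM, hmax⟩ := exists_det_max G isClosed_singleton hne
  exact ⟨M, hM, tau_eq_det hM hmax, hmax⟩

theorem trace_inv_mul_nonpos_of_eventually_det_le {M E : Matrix V V ℝ} (hM : M.PosDef)
    (h : ∀ᶠ s in 𝓝[>] (0 : ℝ), (M + s • E).det ≤ M.det) : (M⁻¹ * E).trace ≤ 0 := by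
  have hd := (hasDerivAt_det_add_smul hM.det_pos.ne'.isUnit E).hasDerivWithinAt (s := Set.Ioi 0)
  rw [hasDerivWithinAt_iff_tendsto_slope' (by simp)] at hd
  have hle : M.det * (M⁻¹ * E).trace ≤ 0 := by
    refine le_of_tendsto hd ?_
    filter_upwards [h, self_mem_nhdsWithin] with s hs hs0
    rw [slope_def_field]
    refine div_nonpos_of_nonpos_of_nonneg ?_ ?_
    · simpa using hs
    · simpa using (Set.mem_Ioi.1 hs0).le
  exact nonpos_of_mul_nonpos_right hle hM.det_pos

/-- First-order optimality in the direction of a symmetric pair of off-diagonal entries. -/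
theorem mul_inv_apply_nonpos_of_max {G : SimpleGraph V} {C : Set ℝ} {M : Matrix V V ℝ}
    (hM : M ∈ admissibleIn G C) (hmax : ∀ N ∈ admissibleIn G C, N.det ≤ M.det) {u v : V}
    (huv : u ≠ v) (σ : ℝ)
    (hfeas : G.Adj u v → ∀ᶠ s in 𝓝[>] (0 : ℝ), M u v + s * σ ∈ C) : σ * M⁻¹ u v ≤ 0 := by
  have hsymM : ∀ i j, M i j = M j i := fun i j => by simpa using hM.1.1.apply j i
  have hsym : ∀ i j, M⁻¹ i j = M⁻¹ j i := fun i j => by simpa using hM.1.inv.1.apply j i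
  set E : Matrix V V ℝ := single u v σ + single v u σ with hE
  have hEH : E.IsHermitian := by
    rw [hE, IsHermitian, conjTranspose_add, conjTranspose_single, conjTranspose_single,
      add_comm]
    simp
  have htr : (M⁻¹ * E).trace = 2 * (σ * M⁻¹ u v) := by
    rw [hE, Matrix.mul_add, trace_add, trace_mul_single, trace_mul_single]
    simp [hsym v u]
    ring
  have := trace_inv_mul_nonpos_of_eventually_det_le (E := E) hM.1 ?_
  · linarith
  have hpd := (hM.1.eventually_add_smul hEH).filter_mono
    (nhdsWithin_le_nhds (s := Set.Ioi (0 : ℝ)))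
  have hfeas' : ∀ᶠ s in 𝓝[>] (0 : ℝ), G.Adj u v → M u v + s * σ ∈ C := by
    by_cases h : G.Adj u v
    · simpa [h] using hfeas h
    · simp [h]
  filter_upwards [hpd, hfeas'] with s hs hsC
  refine hmax _ ⟨hs, fun i => ?_, fun i j hij => ?_⟩
  · have h1 : ¬ (u = i ∧ v = i) := fun h => huv (h.1.trans h.2.symm)
    have h2 : ¬ (v = i ∧ u = i) := fun h => huv (h.2.trans h.1.symm)
    simp [hE, h1, h2, hM.2.1]
  · by_cases h1 : u = i ∧ v = j
    · obtain ⟨rfl, rfl⟩ := h1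
      simpa [hE, single_apply, huv, huv.symm] using hsC hij
    · by_cases h2 : v = i ∧ u = j
      · obtain ⟨rfl, rfl⟩ := h2
        simpa [hE, single_apply, huv, huv.symm, hsymM v u] using hsC hij.symm
      · simpa [hE, single_apply, h1, h2] using hM.2.2 i j hij

/-- An entry at a non-edge is free to move in both directions. -/
theorem inv_apply_eq_zero_of_max {G : SimpleGraph V} {C : Set ℝ} {M : Matrix V V ℝ}
    (hM : M ∈ admissibleIn G C) (hmax : ∀ N ∈ admissibleIn G C, N.det ≤ M.det) {u v : V}
    (huv : u ≠ v) (h : ¬ G.Adj u v) : M⁻¹ u v = 0 := by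
  have h1 := mul_inv_apply_nonpos_of_max hM hmax huv 1 fun h' => absurd h' h
  have h2 := mul_inv_apply_nonpos_of_max hM hmax huv (-1) fun h' => absurd h' h
  linarith

omit [DecidableEq V] in
theorem trace_mul_sub_of_admissible {G : SimpleGraph V} [DecidableRel G.Adj] {x t : ℝ}
    {M N P : Matrix V V ℝ} (hM : M ∈ admissible G x) (hN : N ∈ admissible G t)
    (hP : ∀ u v, u ≠ v → ¬ G.Adj u v → P u v = 0) :
    (P * (N - M)).trace = (t - x) * (P * G.adjMatrix ℝ).trace := by
  simp only [trace, diag_apply, Matrix.mul_apply, Finset.mul_sum]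
  refine Finset.sum_congr rfl fun u _ => Finset.sum_congr rfl fun v _ => ?_
  by_cases h : G.Adj v u
  · rw [Matrix.sub_apply, hN.2.2 v u h, hM.2.2 v u h, SimpleGraph.adjMatrix_apply, if_pos h]
    ring
  · rcases eq_or_ne u v with rfl | huv
    · simp [hN.2.1, hM.2.1]
    · simp [hP u v huv fun h' => h h'.symm]

omit [Fintype V] [DecidableEq V] in
theorem add_smul_adjMatrix_mem_admissible {G : SimpleGraph V} [DecidableRel G.Adj] {x : ℝ}
    {M : Matrix V V ℝ} (hM : M ∈ admissible G x) {s : ℝ} (h : (M + s • G.adjMatrix ℝ).PosDef) :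
    M + s • G.adjMatrix ℝ ∈ admissible G (x + s) := by
  refine ⟨h, fun i => ?_, fun i j hij => ?_⟩
  · simp [hM.2.1]
  · simp [hM.2.2 i j hij, hij]

/-- A matrix of `admissible G x` whose inverse is supported on `G` maximizes the determinant. -/
theorem tau_eq_det_of_inv_support {G : SimpleGraph V} [DecidableRel G.Adj] {x : ℝ}
    {M : Matrix V V ℝ} (hM : M ∈ admissible G x)
    (hP : ∀ u v, u ≠ v → ¬ G.Adj u v → M⁻¹ u v = 0) : tau G x = M.det := by
  refine tau_eq_det hM fun N hN => (hM.1.det_le_det_mul_exp_trace hN.1.posSemidef).trans ?_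
  rw [trace_mul_sub_of_admissible hM hN hP]
  simp

/-- An envelope argument: near x, τ lies above the determinant of the feasible perturbation M +
(t-x)A and below det M · exp((t-x)c), by concavity of log det. Both bounds touch τ at x with the
same slope, so the dependence of the optimal matrix on t is never needed. -/
theorem hasDerivAt_tau {G : SimpleGraph V} [DecidableRel G.Adj] {x : ℝ}
    {M : Matrix V V ℝ} (hM : M ∈ admissible G x)
    (hP : ∀ u v, u ≠ v → ¬ G.Adj u v → M⁻¹ u v = 0) :
    HasDerivAt (tau G) (M.det * (M⁻¹ * G.adjMatrix ℝ).trace) x := by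
  set c := (M⁻¹ * G.adjMatrix ℝ).trace with hc
  have hAH : (G.adjMatrix ℝ).IsHermitian := by
    rw [IsHermitian, conjTranspose_eq_transpose_of_trivial, SimpleGraph.transpose_adjMatrix]
  have hsub : HasDerivAt (fun t : ℝ => t - x) 1 x := (hasDerivAt_id x).sub_const x
  have ht : Tendsto (fun t : ℝ => t - x) (𝓝 x) (𝓝 0) := by
    simpa using hsub.continuousAt.tendsto
  -- This also shows that the maximum exists on both sides of x, including negative t when x = 0.
  have hadm : ∀ᶠ t in 𝓝 x, M + (t - x) • G.adjMatrix ℝ ∈ admissible G t := by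
    filter_upwards [ht.eventually (hM.1.eventually_add_smul hAH)] with t h
    simpa using add_smul_adjMatrix_mem_admissible hM h
  have hl : HasDerivAt (fun t => (M + (t - x) • G.adjMatrix ℝ).det) (M.det * c) x := by
    have h0 : HasDerivAt (fun s : ℝ => (M + s • G.adjMatrix ℝ).det) (M.det * c)
        ((fun t : ℝ => t - x) x) := by
      simpa using hasDerivAt_det_add_smul hM.1.det_pos.ne'.isUnit (G.adjMatrix ℝ)
    simpa [Function.comp_def] using HasDerivAt.comp (h := fun t : ℝ => t - x) x h0 hsub
  have hu : HasDerivAt (fun t => M.det * Real.exp ((t - x) * c)) (M.det * c) x := by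
    refine (((hsub.mul_const c).exp).const_mul M.det).congr_deriv ?_
    simp
  have htau := tau_eq_det_of_inv_support hM hP
  refine hasDerivAt_of_squeeze hl hu ?_ ?_ (by simp [htau]) (by simp [htau])
  · filter_upwards [hadm] with t h
    obtain ⟨N, -, hN, hmax⟩ := exists_tau_eq_det ⟨_, h⟩
    exact hN ▸ hmax _ h
  · filter_upwards [hadm] with t h
    obtain ⟨N, hNt, hN, -⟩ := exists_tau_eq_det ⟨_, h⟩
    rw [hN, hc, ← trace_mul_sub_of_admissible hM hNt hP]
    exact hM.1.det_le_det_mul_exp_trace hNt.1.posSemidef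

end Relaxed

/-! ### Lower bounds for the inverse at the edges -/

section EdgeBound

variable {V : Type*} [Fintype V] [DecidableEq V]

theorem sum_inv_mul_apply {M : Matrix V V ℝ} (hM : M.PosDef) (u w : V) :
    ∑ v, M⁻¹ u v * M v w = if u = w then 1 else 0 := by
  rw [← Matrix.mul_apply, nonsing_inv_mul _ hM.det_pos.ne'.isUnit, one_apply]

/-- The path product inequality for inverse M-matrices with unit diagonal. -/
theorem mul_apply_le_apply_of_inv_offDiag_nonpos {M : Matrix V V ℝ} (hM : M.PosDef)
    (hd : ∀ i, M i i = 1) (hoff : ∀ i j, i ≠ j → M⁻¹ i j ≤ 0) (u v w : V) :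
    M u v * M v w ≤ M u w := by
  -- M⁻¹ sends this vector to e_w - M_vw e_v, and the vector vanishes at v because M_vv = 1, so the
  -- only possibly negative coordinate of the image is harmless.
  have h := hM.inv.nonneg_of_mulVec_nonneg hoff
    (g := fun u => M u w - M u v * M v w) (fun i hi => ?_) u
  · exact sub_nonneg.1 h
  have hiv : i ≠ v := by
    rintro rfl
    simp [hd] at hi
  have : (M⁻¹ *ᵥ fun u => M u w - M u v * M v w) i = if i = w then 1 else 0 := by
    simp only [mulVec, dotProduct, mul_sub, Finset.sum_sub_distrib, ← mul_assoc,
      ← Finset.sum_mul, sum_inv_mul_apply hM, if_neg hiv, zero_mul, sub_zero]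
  rw [this]
  split_ifs <;> norm_num

/-- `M⁻¹` has nonpositive off-diagonal entries, which vanish wherever `M` differs from `x`. -/
structure IsComplementary (M : Matrix V V ℝ) (x : ℝ) : Prop where
  posDef : M.PosDef
  diag : ∀ i, M i i = 1
  inv_nonpos : ∀ i j, i ≠ j → M⁻¹ i j ≤ 0
  eq_of_inv_ne_zero : ∀ i j, i ≠ j → M⁻¹ i j ≠ 0 → M i j = x

namespace IsComplementary

variable {M : Matrix V V ℝ} {x : ℝ}

/-- The (u,u) entry of M⁻¹M = 1: off the diagonal, complementarity permits replacing M by x. -/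
theorem mul_sum_inv_add (h : IsComplementary M x) (u : V) :
    x * ∑ v, M⁻¹ u v + (1 - x) * M⁻¹ u u = 1 := by
  have hsymM : ∀ i j, M i j = M j i := fun i j => by simpa using h.posDef.1.apply j i
  have h1 := sum_inv_mul_apply h.posDef u u
  rw [if_pos rfl] at h1
  refine Eq.trans ?_ h1
  have h2 : ∀ v, M⁻¹ u v * M v u = x * M⁻¹ u v + if u = v then (1 - x) * M⁻¹ u u else 0 := by
    intro v
    rcases eq_or_ne u v with rfl | huv
    · simp [h.diag]
      ring
    · rw [if_neg huv, hsymM v u]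
      by_cases h0 : M⁻¹ u v = 0
      · simp [h0]
      · rw [h.eq_of_inv_ne_zero u v huv h0]
        ring
  simp only [h2, Finset.sum_add_distrib, Finset.sum_ite_eq, Finset.mem_univ, if_true,
    Finset.mul_sum]

/-- Expand the (u,w) entry of M⁻¹M = 1 when M_uw = x. For any other v with M⁻¹_uv ≠ 0, the path
product inequality gives M_vw ≥ M_vu M_uw = x², and M⁻¹_uv ≤ 0 reverses it. The resulting sum is
evaluated by `mul_sum_inv_add`. -/
theorem neg_le_inv_apply (h : IsComplementary M x) (hx0 : 0 ≤ x) {u w : V}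
    (huw : u ≠ w) : -x ≤ (1 - x ^ 2) * M⁻¹ u w := by
  by_cases h0 : M⁻¹ u w = 0
  · simpa [h0] using hx0
  have hsymM : ∀ i j, M i j = M j i := fun i j => by simpa using h.posDef.1.apply j i
  have h1 := sum_inv_mul_apply h.posDef u w
  rw [if_neg huw] at h1
  have hw := h.eq_of_inv_ne_zero u w huw h0
  have h2 : ∀ v, M⁻¹ u v * M v w ≤ x ^ 2 * M⁻¹ u v +
      (if u = v then (x - x ^ 2) * M⁻¹ u u else 0) +
      if w = v then (1 - x ^ 2) * M⁻¹ u w else 0 := by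
    intro v
    rcases eq_or_ne u v with rfl | huv
    · rw [if_pos rfl, if_neg huw.symm, hw]
      linarith
    rcases eq_or_ne w v with rfl | hwv
    · rw [if_pos rfl, if_neg huw, h.diag]
      linarith
    rw [if_neg huv, if_neg hwv]
    by_cases hv0 : M⁻¹ u v = 0
    · simp [hv0]
    have hv := h.eq_of_inv_ne_zero u v huv hv0
    have hp := mul_apply_le_apply_of_inv_offDiag_nonpos h.posDef h.diag h.inv_nonpos v u w
    rw [hsymM v u, hv, hw] at hp
    nlinarith [h.inv_nonpos u v huv]
  have h3 := Finset.sum_le_sum fun v (_ : v ∈ Finset.univ) => h2 v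
  simp only [Finset.sum_add_distrib, ← Finset.mul_sum, Finset.sum_ite_eq, Finset.mem_univ,
    if_true, h1] at h3
  nlinarith [h.mul_sum_inv_add u]

theorem apply_le (h : IsComplementary M x) (hx0 : 0 ≤ x)
    (hrow : ∀ u, 0 ≤ ∑ v, M⁻¹ u v) {u w : V} (huw : u ≠ w) : M u w ≤ x := by
  -- The correction at w makes the vector vanish there. Where it is negative, M_iw ≠ x, so M⁻¹_iw =
  -- 0 and the image is x times a row sum.
  have hg := h.posDef.inv.nonneg_of_mulVec_nonneg h.inv_nonpos
    (g := fun u => x - M u w + if w = u then 1 - x else 0) (fun i hi => ?_) u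
  · simpa [huw.symm] using hg
  have hiw : i ≠ w := by
    rintro rfl
    simp [h.diag] at hi
  have h0 : M⁻¹ i w = 0 := by
    by_contra h0
    simp [h.eq_of_inv_ne_zero i w hiw h0, hiw.symm] at hi
  have : (M⁻¹ *ᵥ fun u => x - M u w + if w = u then 1 - x else 0) i = (∑ v, M⁻¹ i v) * x := by
    simp only [mulVec, dotProduct, mul_add, mul_sub, Finset.sum_sub_distrib,
      Finset.sum_add_distrib, sum_inv_mul_apply h.posDef, if_neg hiw, Finset.sum_mul]
    simp [h0]
  rw [this]
  exact mul_nonneg (hrow i) hx0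

end IsComplementary

/-! ### The two ranges of x, and the single edge -/

theorem admissible_nonempty (G : SimpleGraph V) {x : ℝ} (hx0 : 0 ≤ x) (hx1 : x < 1) :
    (admissible G x).Nonempty := by
  refine ⟨(1 - x) • (1 : Matrix V V ℝ) + x • vecMulVec 1 (star 1),
    (PosDef.one.smul (sub_pos.2 hx1)).add_posSemidef
      ((posSemidef_vecMulVec_self_star _).smul hx0), fun i => ?_, fun i j h => ?_⟩
  · simp
  · simp [h.ne]

omit [DecidableEq V] in
theorem sum_adjMatrix (G : SimpleGraph V) [DecidableRel G.Adj] :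
    ∑ u, ∑ v, G.adjMatrix ℝ u v = ∑ u, (G.degree u : ℝ) := by
  simp [SimpleGraph.adjMatrix_apply, SimpleGraph.degree, SimpleGraph.neighborFinset_eq_filter]

omit [DecidableEq V] in
theorem sum_degree_eq (G : SimpleGraph V) [DecidableRel G.Adj] :
    ∑ u, (G.degree u : ℝ) = 2 * (Nat.card G.edgeSet : ℝ) := by
  rw [Nat.card_eq_fintype_card, ← SimpleGraph.edgeFinset_card]
  exact_mod_cast G.sum_degrees_eq_twice_card_edges

/-- If `x (Δ - 1) ≤ 1`, the optimal matrix has all entries of its inverse at edges at least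
`-x / (1 - x ^ 2)`. -/
theorem exists_optimal_of_degree_bound (G : SimpleGraph V) [DecidableRel G.Adj] {x : ℝ}
    (hx0 : 0 ≤ x) (hx1 : x < 1) (hdeg : ∀ u, ((G.degree u : ℝ) - 1) * x ≤ 1) :
    ∃ M ∈ admissible G x, (∀ u v, u ≠ v → ¬ G.Adj u v → M⁻¹ u v = 0) ∧
      ∀ u v, G.Adj u v → -x ≤ (1 - x ^ 2) * M⁻¹ u v := by
  -- Edge entries are relaxed to be at least x, which gives the multipliers a sign; the last step
  -- shows that the relaxation is tight.
  have hne : (admissibleIn G (Set.Ici x)).Nonempty := by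
    obtain ⟨N, hN⟩ := admissible_nonempty G hx0 hx1
    exact ⟨N, hN.1, hN.2.1, fun i j h => (hN.2.2 i j h).ge⟩
  obtain ⟨M, hM, hmax⟩ := exists_det_max G isClosed_Ici hne
  have hzero : ∀ u v, u ≠ v → ¬ G.Adj u v → M⁻¹ u v = 0 := fun u v =>
    inv_apply_eq_zero_of_max hM hmax
  have hcomp : IsComplementary M x := by
    refine ⟨hM.1, hM.2.1, fun u v huv => ?_, fun u v huv h0 => ?_⟩
    · have := mul_inv_apply_nonpos_of_max hM hmax huv 1 fun h => by
        filter_upwards [self_mem_nhdsWithin] with s hs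
        have := Set.mem_Ici.1 (hM.2.2 u v h)
        have := Set.mem_Ioi.1 hs
        rw [Set.mem_Ici]
        linarith
      linarith
    -- Complementary slackness: an edge entry above x can move both ways, which would make the
    -- inverse vanish there.
    · by_contra hne
      have hadj : G.Adj u v := by
        by_contra h
        exact h0 (hzero u v huv h)
      have hlt : 0 < M u v - x := sub_pos.2 (lt_of_le_of_ne (hM.2.2 u v hadj) (Ne.symm hne))
      have h1 := mul_inv_apply_nonpos_of_max hM hmax huv 1 fun h => by
        filter_upwards [self_mem_nhdsWithin] with s hs
        have := Set.mem_Ioi.1 hs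
        rw [Set.mem_Ici]
        linarith
      have h2 := mul_inv_apply_nonpos_of_max hM hmax huv (-1) fun h => by
        filter_upwards [nhdsWithin_le_nhds (eventually_lt_nhds hlt)] with s hs
        rw [Set.mem_Ici]
        linarith
      exact h0 (by linarith)
  have hx2 : 0 < 1 - x ^ 2 := by nlinarith
  have hrow : ∀ u, 0 ≤ ∑ v, M⁻¹ u v := by
    intro u
    have h1 : ∀ v, (if u = v then (1 - x ^ 2) * M⁻¹ u u else 0) + -x * G.adjMatrix ℝ u v ≤
        (1 - x ^ 2) * M⁻¹ u v := by
      intro v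
      rcases eq_or_ne u v with rfl | huv
      · simp
      · by_cases h : G.Adj u v
        · simpa [huv, h] using hcomp.neg_le_inv_apply hx0 huv
        · simp [huv, h, hzero u v huv h]
    have h2 := Finset.sum_le_sum fun v (_ : v ∈ Finset.univ) => h1 v
    have h3 : ∑ v, G.adjMatrix ℝ u v = (G.degree u : ℝ) := by
      simp [SimpleGraph.adjMatrix_apply, SimpleGraph.degree,
        SimpleGraph.neighborFinset_eq_filter]
    simp only [Finset.sum_add_distrib, ← Finset.mul_sum, Finset.sum_ite_eq, Finset.mem_univ,
      if_true, h3] at h2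
    have h4 := hcomp.mul_sum_inv_add u
    have h5 : (1 + x) * (x * ∑ v, M⁻¹ u v + (1 - x) * M⁻¹ u u) = 1 + x := by
      rw [h4, mul_one]
    -- Eliminating M⁻¹_uu between `h2` and `h5` leaves (1+x) · (row sum) ≥ 1 - x(deg u - 1).
    have h7 : 0 ≤ (1 + x) * ∑ v, M⁻¹ u v := by
      linarith [hdeg u]
    exact nonneg_of_mul_nonneg_right h7 (by linarith)
  refine ⟨M, ⟨hM.1, hM.2.1, fun i j h => le_antisymm (hcomp.apply_le hx0 hrow h.ne)
    (hM.2.2 i j h)⟩, hzero, fun u v h => hcomp.neg_le_inv_apply hx0 h.ne⟩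

/-- Subtract tr M⁻¹ + x tr(M⁻¹A) = tr(M⁻¹M) = n from tr M⁻¹ + tr(M⁻¹A) = 1ᵀM⁻¹1 ≥ 0. -/
theorem card_le_of_admissible {G : SimpleGraph V} [DecidableRel G.Adj] {x : ℝ}
    {M : Matrix V V ℝ} (hM : M ∈ admissible G x)
    (hP : ∀ u v, u ≠ v → ¬ G.Adj u v → M⁻¹ u v = 0) :
    -(Fintype.card V : ℝ) ≤ (1 - x) * (M⁻¹ * G.adjMatrix ℝ).trace := by
  have hA : ∀ u v, M⁻¹ u v = (if u = v then M⁻¹ u u else 0) + M⁻¹ u v * G.adjMatrix ℝ v u := by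
    intro u v
    rcases eq_or_ne u v with rfl | huv
    · simp
    · by_cases h : G.Adj u v
      · simp [huv, h.symm]
      · simp [huv, hP u v huv h]
  have hAM : ∀ u v, M⁻¹ u v * M v u =
      (if u = v then M⁻¹ u u else 0) + x * (M⁻¹ u v * G.adjMatrix ℝ v u) := by
    intro u v
    rcases eq_or_ne u v with rfl | huv
    · simp [hM.2.1]
    · by_cases h : G.Adj u v
      · simp [huv, h.symm, hM.2.2 v u h.symm, mul_comm]
      · simp [huv, hP u v huv h]
  have hc : (M⁻¹ * G.adjMatrix ℝ).trace = ∑ u, ∑ v, M⁻¹ u v * G.adjMatrix ℝ v u := by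
    simp only [trace, diag_apply, Matrix.mul_apply]
  have h1 : (Fintype.card V : ℝ) =
      ∑ u, M⁻¹ u u + x * (M⁻¹ * G.adjMatrix ℝ).trace := by
    have : ∀ u, ∑ v, M⁻¹ u v * M v u = 1 := fun u => by simp [sum_inv_mul_apply hM.1]
    simp_rw [hAM, Finset.sum_add_distrib, ← Finset.mul_sum] at this
    have h := Finset.sum_congr (rfl : (Finset.univ : Finset V) = _) fun u _ => this u
    simp only [Finset.sum_add_distrib, Finset.sum_ite_eq, Finset.mem_univ, if_true,
      ← Finset.mul_sum, ← hc, Finset.sum_const, Finset.card_univ, nsmul_eq_mul, mul_one] at h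
    exact h.symm
  have h2 : 0 ≤ ∑ u, M⁻¹ u u + (M⁻¹ * G.adjMatrix ℝ).trace := by
    have h := hM.1.inv.posSemidef.dotProduct_mulVec_nonneg 1
    have h' : star (1 : V → ℝ) ⬝ᵥ (M⁻¹ *ᵥ 1) = ∑ u, ∑ v, M⁻¹ u v := by
      simp [dotProduct, mulVec]
    rw [h', Finset.sum_congr rfl fun u _ => Finset.sum_congr rfl fun v _ => hA u v] at h
    simpa only [Finset.sum_add_distrib, Finset.sum_ite_eq, Finset.mem_univ, if_true, ← hc] using h
  linarith

theorem tau_top_fin_two {t : ℝ} (ht : |t| < 1) : tau (⊤ : SimpleGraph (Fin 2)) t = 1 - t ^ 2 := by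
  have hM : !![1, t; t, 1] ∈ admissible (⊤ : SimpleGraph (Fin 2)) t := by
    refine ⟨.of_dotProduct_mulVec_pos ?_ fun v hv => ?_, fun i => ?_, fun i j h => ?_⟩
    · ext i j
      fin_cases i <;> fin_cases j <;> simp
    · have hne : v 0 ≠ 0 ∨ v 1 ≠ 0 := by
        by_contra! h
        exact hv (funext fun i => by fin_cases i <;> simp [h.1, h.2])
      have hpos : 0 < v 0 ^ 2 + v 1 ^ 2 := by
        rcases hne with h | h <;> positivity
      have ht' := abs_lt.1 ht
      simp only [star_trivial, dotProduct, mulVec, Fin.sum_univ_two, of_apply, cons_val_zero,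
        cons_val_one, cons_val', cons_val_fin_one]
      rcases le_total 0 t with h0 | h0
      · nlinarith [mul_nonneg h0 (sq_nonneg (v 0 + v 1)), mul_pos (sub_pos.2 ht'.2) hpos]
      · nlinarith [mul_nonneg (neg_nonneg.2 h0) (sq_nonneg (v 0 - v 1)),
          mul_pos (neg_lt_iff_pos_add.1 ht'.1) hpos]
    · fin_cases i <;> simp
    · fin_cases i <;> fin_cases j <;> simp_all
  rw [tau_eq_det_of_inv_support hM fun u v huv h => absurd huv (by simpa using h), det_fin_two_of]
  ring

theorem deriv_tau_top_fin_two {x : ℝ} (hx : |x| < 1) :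
    deriv (tau (⊤ : SimpleGraph (Fin 2))) x = -(2 * x) := by
  have h : tau (⊤ : SimpleGraph (Fin 2)) =ᶠ[𝓝 x] fun t => 1 - t ^ 2 := by
    filter_upwards [continuous_abs.continuousAt.eventually_lt_const hx] with t ht
    exact tau_top_fin_two ht
  rw [h.deriv_eq]
  simp

end EdgeBound

theorem theorem3 {V : Type*} [Fintype V] [DecidableEq V] (G : SimpleGraph V) [DecidableRel G.Adj]
    (x : ℝ) (hx0 : 0 ≤ x) (hx1 : x < 1)
    (hx : (G.maxDegree ≤ 1 ∨ x ≤ 1 / ((G.maxDegree : ℝ) - 1)) ∨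
      (1 < averageDegree G ∧ 1 / (averageDegree G - 1) ≤ x)) :
    0 < tau G x ∧ DifferentiableAt ℝ (tau G) x ∧
      deriv (tau G) x / tau G x ≥
        (Nat.card G.edgeSet : ℝ) *
          (deriv (tau (⊤ : SimpleGraph (Fin 2))) x / tau (⊤ : SimpleGraph (Fin 2)) x) := by
  have hxa : |x| < 1 := by rwa [abs_of_nonneg hx0]
  have hx2 : 0 < 1 - x ^ 2 := by nlinarith
  rw [tau_top_fin_two hxa, deriv_tau_top_fin_two hxa]
  suffices h : ∃ M ∈ admissible G x, (∀ u v, u ≠ v → ¬ G.Adj u v → M⁻¹ u v = 0) ∧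
      -x * ∑ u, (G.degree u : ℝ) ≤ (1 - x ^ 2) * (M⁻¹ * G.adjMatrix ℝ).trace by
    obtain ⟨M, hM, hP, hb⟩ := h
    have hd := hasDerivAt_tau hM hP
    have htau := tau_eq_det_of_inv_support hM hP
    have hpos := hM.1.det_pos
    refine ⟨htau ▸ hpos, hd.differentiableAt, ?_⟩
    rw [hd.deriv, htau, mul_div_cancel_left₀ _ hpos.ne', ge_iff_le, mul_div_assoc',
      div_le_iff₀ hx2]
    rw [sum_degree_eq] at hb
    linarith
  rcases hx with hx | ⟨hd1, hdx⟩
  · have hdeg : ∀ u, ((G.degree u : ℝ) - 1) * x ≤ 1 := by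
      intro u
      have hu : (G.degree u : ℝ) ≤ G.maxDegree := by exact_mod_cast G.degree_le_maxDegree u
      have hmono : ((G.degree u : ℝ) - 1) * x ≤ ((G.maxDegree : ℝ) - 1) * x := by gcongr
      refine hmono.trans ?_
      rcases le_or_gt G.maxDegree 1 with h | h
      · have : (G.maxDegree : ℝ) ≤ 1 := by exact_mod_cast h
        nlinarith
      · have hD : (0 : ℝ) < (G.maxDegree : ℝ) - 1 := sub_pos.2 (by exact_mod_cast h)
        have := (le_div_iff₀ hD).1 (hx.resolve_left (not_le.2 h))
        linarith
    obtain ⟨M, hM, hP, hb⟩ := exists_optimal_of_degree_bound G hx0 hx1 hdeg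
    refine ⟨M, hM, hP, ?_⟩
    rw [← sum_adjMatrix]
    simp only [trace, diag_apply, Matrix.mul_apply, Finset.mul_sum]
    refine Finset.sum_le_sum fun u _ => Finset.sum_le_sum fun v _ => ?_
    by_cases h : G.Adj u v
    · simpa [h, h.symm] using hb u v h
    · simp [h, G.adj_comm v u]
  · obtain ⟨M, hM, -, hmax⟩ := exists_tau_eq_det (admissible_nonempty G hx0 hx1)
    have hP : ∀ u v, u ≠ v → ¬ G.Adj u v → M⁻¹ u v = 0 := fun u v =>
      inv_apply_eq_zero_of_max (C := {x}) hM hmax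
    refine ⟨M, hM, hP, ?_⟩
    have hn : (0 : ℝ) < Fintype.card V := by
      refine lt_of_le_of_ne (Nat.cast_nonneg _) fun h => ?_
      -- On an empty vertex set the average degree is 0 by the convention for division,
      -- contradicting d̄ > 1.
      rw [averageDegree, ← h, div_zero] at hd1
      linarith
    have h1 := card_le_of_admissible hM hP
    have h2 : 1 ≤ x * (averageDegree G - 1) := (div_le_iff₀ (sub_pos.2 hd1)).1 hdx
    have h3 : averageDegree G * Fintype.card V = ∑ u, (G.degree u : ℝ) :=
      div_mul_cancel₀ _ hn.ne'
    rw [← h3]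
    -- Multiplying `h1` by 1 + x bounds the right side below by -(1+x)n, and `h2` says 1 + x ≤ x d̄.
    nlinarith
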